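/- For $y\in\mathbb R$ and an integer $m\ge 0$ write $[y]_m=y(y-1)\cdots(y-m+1)$ for the falling factorial; for real $y$ and an integer $x\ge 0$ let $\binom{y}{x}=[y]_x/x!$. **Triangular urns.** Let $1\le\alpha\le\sigma$ and $a_0,b_0\ge 0$ be integers with $a_0+b_0\ge 1$. The triangular urn with replacement matrix $\begin{pmatrix}\alpha&\sigma-\alpha\\0&\sigma\end{pmatrix}$ starts with $a_0$ white and $b_0$ black balls. At each step a ball is drawn uniformly at random and put back; if it is white, $\alpha$ white and $\sigma-\alpha$ black balls are added, and if it is black, $\sigma$ black balls are added. Let $A_m$ be the number of white balls after $m$ steps. **The graph process.** Let $j\ge k\ge 2$ be integers. Start at time $j$ with the complete graph $K_j$ on $v_1,\dots,v_j$. For $t\ge j$, given the graph on $v_1,\dots,v_t$, choose a vertex $w$ with probability proportional to its degree, then a set of $k-1$ distinct neighbours of $w$ uniformly at random, and join a new vertex $v_{t+1}$ to $w$ and to these $k-1$ vertices. Let $d_t(v_i)$ be the degree of $v_i$ when there are $t$ vertices, and put $R=j(j-1)/(2k)$. **Theorem.** 1. For the triangular urn and all integers $m,x\ge 0$, $$\mathbb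 P(A_m=a_0+x\alpha)=\binom{x+\frac{a_0}{\alpha}-1}{x}\sum_{u=0}^{x}(-1)^u\binom{x}{u}\frac{[m+(b_0-\alpha u)/\sigma-1]_m}{[m+(a_0+b_0)/\sigma-1]_m}.$$ 2. Let $1\le i\le j\le n$, so that $v_i$ is a vertex of the seed $K_j$. Then $(k\,d_t(v_i))_{t=j}^{n}$ has the same law as $(A_m)_{m=0}^{n-j}$ for the triangular urn with $\alpha=k$, $\sigma=2k$, $a_0=k(j-1)$, $b_0=(j-k)(j-1)$, and for every integer $x\ge0$ $$\mathbb P(d_n(v_i)=j-1+x)=\binom{x+j-2}{x}\sum_{u=0}^{x}(-1)^u\binom{x}{u}\frac{\left[n-j+\frac{(j-k)(j-1)-ku}{2k}-1\right]_{n-j}}{[n-j+R-1]_{n-j}}.$$ 3. Let $j<i\le n$. Then $(k\,d_t(v_i))_{t=i}^{n}$ has the same law as $(A_m)_{m=0}^{n-i}$ for the triangular urn with $\alpha=k$, $\sigma=2k$, $a_0=k^2$, $b_0=j(j-1)+2(i-j)k-k^2$, and for every integer $x\ge0$ $$\mathbb P(d_n(v_i)=k+x)=\binom{x+k-1}{x}\sum_{u=0}^{x}(-1)^u\binom{x}{u}\frac{\left[n-j+R-\frac{u+k}{2}-1\right]_{n-i}}{[n-j+R-1]_{n-i}}.$$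 -/

import Mathlib

open scoped Classical BigOperators ENNReal

noncomputable section

/-- The probability distribution on the finite set `s` under which `a ∈ s` has probability
`wt a / ∑ b ∈ s, wt b`. -/
def propTo {A : Type*} (s : Finset A) (wt : A → ℕ) (h : ∑ b ∈ s, wt b ≠ 0) : PMF A :=
  PMF.ofFinset (fun a => if a ∈ s then (wt a : ℝ≥0∞) / ((∑ b ∈ s, wt b : ℕ) : ℝ≥0∞) else 0) s
    (by
      have h0 : ((∑ b ∈ s, wt b : ℕ) : ℝ≥0∞) ≠ 0 := by exact_mod_cast h
      have h1 : ((∑ b ∈ s, wt b : ℕ) : ℝ≥0∞) ≠ ⊤ := ENNReal.natCast_ne_top _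
      rw [Finset.sum_congr rfl (fun a ha => if_pos ha)]
      simp only [div_eq_mul_inv]
      rw [← Finset.sum_mul, ← Nat.cast_sum]
      exact ENNReal.mul_inv_cancel h0 h1)
    (by intro a ha; simp [ha])

/-- The law of the first `m` steps of the Markov chain started at `s₀` whose `r`-th transition
(from time `r` to time `r + 1`) is `step r`. Under it, `p r` is the state at time `r ≤ m`;
the coordinates `p r` with `r > m` carry no information (they are constantly `s₀`). -/
def chainLaw {S : Type*} (step : ℕ → S → PMF S) (s₀ : S) : ℕ → PMF (ℕ → S)
  | 0 => PMF.pure (fun _ => s₀)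
  | m + 1 => (chainLaw step s₀ m).bind fun p =>
      (step m (p m)).map fun s => Function.update p (m + 1) s

/-! ### Two-colour urns -/

/-- One step of the urn with replacement matrix `M`. The urn contains `c 0` white and `c 1` black
balls; a ball is drawn uniformly at random and put back, and if its colour is `a` then `M a b`
balls of colour `b` are added, for each `b`. (An empty urn stays as it is.) -/
def urnStep (M : Matrix (Fin 2) (Fin 2) ℕ) (c : Fin 2 → ℕ) : PMF (Fin 2 → ℕ) :=
  if h : ∑ a, c a ≠ 0 then
    (propTo Finset.univ c h).map fun a => fun b => c b + M a b
  else PMF.pure c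

/-- The law of the first `m` steps of the urn that initially has `a₀` white, `b₀` black balls. -/
def urnLaw (M : Matrix (Fin 2) (Fin 2) ℕ) (a₀ b₀ m : ℕ) : PMF (ℕ → Fin 2 → ℕ) :=
  chainLaw (fun _ => urnStep M) ![a₀, b₀] m

/-- The triangular replacement matrix (first row: white ball drawn; first column: white balls
added). It is used for `α ≤ σ` only. -/
def triangularMatrix (α σ : ℕ) : Matrix (Fin 2) (Fin 2) ℕ :=
  !![α, σ - α;
     0, σ]

/-! ### The random graph process

The vertices `v₁, v₂, …` are the positive natural numbers; a graph at time `t` is a simple graph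
whose edges join vertices in `{1, …, t}`. -/

/-- The complete graph on the vertices `1, …, j`. -/
def seedGraph (j : ℕ) : SimpleGraph ℕ where
  Adj a b := a ≠ b ∧ a ∈ Finset.Icc 1 j ∧ b ∈ Finset.Icc 1 j
  symm := ⟨fun _ _ h => ⟨h.1.symm, h.2.2, h.2.1⟩⟩
  loopless := ⟨fun _ h => h.1 rfl⟩

/-- The neighbours of `v` among the vertices `1, …, t`. -/
def nbrs (t : ℕ) (G : SimpleGraph ℕ) (v : ℕ) : Finset ℕ :=
  (Finset.Icc 1 t).filter fun u => G.Adj v u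

/-- The degree of `v` in a graph at time `t`. -/
def deg (t : ℕ) (G : SimpleGraph ℕ) (v : ℕ) : ℕ := (nbrs t G v).card

/-- The graph `G` with edges from `v` to all elements of `T` (other than `v`) added. -/
def attach (G : SimpleGraph ℕ) (v : ℕ) (T : Finset ℕ) : SimpleGraph ℕ :=
  G ⊔ SimpleGraph.fromRel fun a b => a = v ∧ b ∈ T

/-- One step of the graph process, from time `t` to time `t + 1`: a vertex `w` among `1, …, t` is
chosen with probability proportional to its degree, then a set `T` of `k - 1` neighbours of `w`
uniformly at random, and the new vertex `t + 1` is joined to `w` and to all of `T`. (The graph is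
left unchanged when these choices are impossible, that is, when it has no edge or `w` has fewer
than `k - 1` neighbours; this never happens when all vertices of a nonempty graph have degree at
least `k - 1 ≥ 1`.) -/
def graphStep (k t : ℕ) (G : SimpleGraph ℕ) : PMF (SimpleGraph ℕ) :=
  if h : ∑ v ∈ Finset.Icc 1 t, deg t G v ≠ 0 then
    (propTo (Finset.Icc 1 t) (deg t G) h).bind fun w =>
      if h' : (Finset.powersetCard (k - 1) (nbrs t G w)).Nonempty then
        (PMF.uniformOfFinset _ h').map fun T => attach G (t + 1) (insert w T)
      else PMF.pure G
  else PMF.pure G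

/-- The law of the graph process started from the complete graph on `j` vertices and run until
there are `n ≥ j` vertices: under it, `p r` is the graph at time `j + r`, that is, when there are
`j + r` vertices, for `0 ≤ r ≤ n - j`. -/
def graphLaw (k j n : ℕ) : PMF (ℕ → SimpleGraph ℕ) :=
  chainLaw (fun r => graphStep k (j + r)) (seedGraph j) (n - j)

/-- The distribution of the degree `d_n(v_i)` in the graph at time `n`. -/
def degreeLaw (k j n i : ℕ) : PMF ℕ :=
  (graphLaw k j n).map fun p => deg n (p (n - j)) i

/-- The falling factorial `[y]_m = y (y - 1) ⋯ (y - m + 1)`. -/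
def fallingFactorial (y : ℝ) (m : ℕ) : ℝ := ∏ l ∈ Finset.range m, (y - l)

end

/-! ### Probability mass functions -/

/-! Urn: each draw adds `σ` balls, so the total at time `m` is deterministic and the number `x` of
white draws is itself a Markov chain, moving up with probability `(a₀ + xα) / (a₀ + b₀ + mσ)`. The
explicit formula is checked by induction on `m` in `whiteDrawLaw_apply`: the `u`-th summand gains a
factor proportional to `(b₀ + mσ)/α - u`, and `alternating_sum_recurrence` splits the result into
the two terms of the one-step recurrence.

Graph: let `D` be the degree sum. The new vertex is joined to `i` if `w = i`, or if `w` is a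
neighbour of `i` and `i ∈ T`. The latter has probability `(deg w / D) * ((k - 1) / deg w)` for each
such `w`; `deg w` cancels, and the sum is `k * deg i / D` (`attachSetLaw_prob_mem`). As `D` grows by
`2k` per step, `(k * deg i, D - k * deg i)` moves like the triangular urn with `α = k`, `σ = 2k`
(`graphStep_map_deg`). `chainLaw_map_lump` lifts this from steps to paths. -/

theorem PMF.bind_congr_of_support {A B : Type*} (p : PMF A) {f g : A → PMF B}
    (h : ∀ a ∈ p.support, f a = g a) : p.bind f = p.bind g := by
  ext b
  rw [PMF.bind_apply, PMF.bind_apply]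
  refine tsum_congr fun a => ?_
  by_cases ha : p a = 0
  · simp [ha]
  · rw [h a ((PMF.mem_support_iff _ _).2 ha)]

theorem PMF.map_congr_of_support {A B : Type*} (p : PMF A) {f g : A → B}
    (h : ∀ a ∈ p.support, f a = g a) : p.map f = p.map g :=
  p.bind_congr_of_support fun a ha => by simp [h a ha]

theorem PMF.map_apply_of_injective {A B : Type*} (p : PMF A) {f : A → B}
    (hf : Function.Injective f) (a : A) : p.map f (f a) = p a := by
  rw [PMF.map_apply, tsum_eq_single a]
  · simp
  · intro b hb
    rw [if_neg]
    exact fun h => hb (hf h).symm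

theorem PMF.ext_of_apply_true {p q : PMF Bool} (h : p true = q true) : p = q := by
  have hp := p.tsum_coe
  have hq := q.tsum_coe
  rw [tsum_bool] at hp hq
  ext b
  cases b
  · rw [h, ← hq] at hp
    exact (ENNReal.add_left_inj (q.apply_ne_top true)).1 hp
  · exact h

theorem propTo_apply {A : Type*} (s : Finset A) (wt : A → ℕ) (h : ∑ b ∈ s, wt b ≠ 0) (a : A) :
    propTo s wt h a = if a ∈ s then (wt a : ℝ≥0∞) / ((∑ b ∈ s, wt b : ℕ) : ℝ≥0∞) else 0 :=
  rfl

/-! ### Lumping of Markov chains -/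

section Chain

variable {S T : Type*}

/-- Lets step identities be checked on reachable states only, where the natural-number subtractions
are genuine. -/
theorem chainLaw_support_invariant {step : ℕ → S → PMF S} {s₀ : S} {Inv : ℕ → S → Prop}
    (h0 : Inv 0 s₀) (hs : ∀ r s, Inv r s → ∀ s' ∈ (step r s).support, Inv (r + 1) s') (m : ℕ) :
    ∀ p ∈ (chainLaw step s₀ m).support, Inv m (p m) := by
  induction m with
  | zero =>
    intro p hp
    simp only [chainLaw, PMF.support_pure, Set.mem_singleton_iff] at hp
    rw [hp]; exact h0
  | succ m ih =>
    intro p hp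
    simp only [chainLaw, PMF.mem_support_bind_iff, PMF.mem_support_map_iff] at hp
    obtain ⟨q, hq, s, hs', rfl⟩ := hp
    rw [Function.update_self]
    exact hs m _ (ih q hq) s hs'

/-- If `f m` turns the step of one chain at time `r₀ + m` into the step of another chain at time
`m`, and is constant at time `r₀`, then it turns the law of the first chain from time `r₀` on into
the law of the second chain. -/
theorem chainLaw_map_lump {step : ℕ → S → PMF S} {s₀ : S} {step' : ℕ → T → PMF T} {t₀ : T}
    {Inv : ℕ → S → Prop} (h0 : Inv 0 s₀)
    (hs : ∀ r s, Inv r s → ∀ s' ∈ (step r s).support, Inv (r + 1) s')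
    (f : ℕ → S → T) (r₀ : ℕ) (hbase : ∀ s, Inv r₀ s → f 0 s = t₀)
    (hstep : ∀ m s, Inv (r₀ + m) s → (step (r₀ + m) s).map (f (m + 1)) = step' m (f m s)) (m : ℕ) :
    (chainLaw step s₀ (r₀ + m)).map (fun p r => if r ≤ m then f r (p (r₀ + r)) else t₀) =
      chainLaw step' t₀ m := by
  induction m with
  | zero =>
    -- Coordinates after the running time are frozen at `t₀`, and coordinate `0` equals `t₀` on the
    -- support, so the image path is constant.
    have : (chainLaw step s₀ (r₀ + 0)).map (fun p r => if r ≤ 0 then f r (p (r₀ + r)) else t₀) =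
        (chainLaw step s₀ (r₀ + 0)).map (Function.const _ fun _ => t₀) := by
      refine PMF.map_congr_of_support _ fun p hp => funext fun r => ?_
      have := hbase _ (chainLaw_support_invariant h0 hs _ p hp)
      rcases Nat.eq_zero_or_pos r with rfl | hr
      · simpa using this
      · simp [hr.ne']
    rw [this, PMF.map_const]
    rfl
  | succ m ih =>
    rw [← add_assoc]
    simp only [chainLaw]
    rw [← ih, PMF.map_bind, PMF.bind_map]
    refine PMF.bind_congr_of_support _ fun p hp => ?_
    have hI := chainLaw_support_invariant h0 hs _ p hp
    simp only [Function.comp_apply, le_refl, if_true]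
    rw [← hstep m _ hI, PMF.map_comp, PMF.map_comp]
    congr 1
    funext s r
    simp only [Function.comp_apply]
    rcases lt_trichotomy r (m + 1) with hr | rfl | hr
    · rw [if_pos hr.le, Function.update_of_ne (by omega), Function.update_of_ne (by omega),
        if_pos (by omega)]
    · rw [if_pos le_rfl, ← add_assoc, Function.update_self, Function.update_self]
    · rw [if_neg (by omega), Function.update_of_ne (by omega), if_neg (by omega)]

theorem chainLaw_marginal_succ (step : ℕ → S → PMF S) (s₀ : S) (m : ℕ) :
    (chainLaw step s₀ (m + 1)).map (fun p => p (m + 1)) =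
      ((chainLaw step s₀ m).map fun p => p m).bind (step m) := by
  simp only [chainLaw]
  rw [PMF.map_bind, PMF.bind_map]
  congr 1
  funext p
  rw [PMF.map_comp]
  have : ((fun p : ℕ → S => p (m + 1)) ∘ fun s => Function.update p (m + 1) s) = id := by
    funext s; simp
  rw [this, PMF.map_id]; rfl

end Chain

/-! ### The triangular urn -/

/-- The composition of the triangular urn after `m` draws of which `x` were white. -/
def triangularState (α σ a₀ b₀ m x : ℕ) : Fin 2 → ℕ :=
  ![a₀ + x * α, b₀ + x * (σ - α) + (m - x) * σ]

/-- The transitions of the number of white draws in a triangular urn. -/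
noncomputable def whiteDrawStep (α σ a₀ b₀ m x : ℕ) : PMF ℕ :=
  if h : ∑ a, triangularState α σ a₀ b₀ m x a ≠ 0 then
    (propTo Finset.univ (triangularState α σ a₀ b₀ m x) h).map fun a => if a = 0 then x + 1 else x
  else PMF.pure x

/-- Both rows of the matrix sum to `σ`, so the total does not depend on the colours drawn. -/
theorem sum_triangularState {α σ m x : ℕ} (a₀ b₀ : ℕ) (hα : α ≤ σ) (hx : x ≤ m) :
    ∑ a, triangularState α σ a₀ b₀ m x a = a₀ + b₀ + m * σ := by
  obtain ⟨σ, rfl⟩ := Nat.exists_eq_add_of_le hα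
  obtain ⟨m, rfl⟩ := Nat.exists_eq_add_of_le hx
  simp [triangularState, Fin.sum_univ_two]
  ring

theorem whiteDrawStep_support {α σ a₀ b₀ m x y : ℕ}
    (hy : y ∈ (whiteDrawStep α σ a₀ b₀ m x).support) : y = x ∨ y = x + 1 := by
  unfold whiteDrawStep at hy
  split_ifs at hy with h
  · rw [PMF.mem_support_map_iff] at hy
    obtain ⟨a, -, rfl⟩ := hy
    split_ifs <;> simp
  · simp at hy; exact Or.inl hy

theorem whiteDrawStep_map_state {α σ a₀ b₀ m x : ℕ} (hα : α ≤ σ) (hx : x ≤ m)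
    (hs : 1 ≤ a₀ + b₀) :
    (whiteDrawStep α σ a₀ b₀ m x).map (triangularState α σ a₀ b₀ (m + 1)) =
      urnStep (triangularMatrix α σ) (triangularState α σ a₀ b₀ m x) := by
  have h : ∑ a, triangularState α σ a₀ b₀ m x a ≠ 0 := by
    rw [sum_triangularState a₀ b₀ hα hx]; omega
  unfold whiteDrawStep urnStep
  rw [dif_pos h, dif_pos h, PMF.map_comp]
  congr 1
  obtain ⟨m, rfl⟩ := Nat.exists_eq_add_of_le hx
  funext a b
  have h1 : x + m + 1 - x = m + 1 := by omega
  fin_cases a <;> fin_cases b <;> simp [triangularState, triangularMatrix, h1] <;> ring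

/-- The law of the number of white draws in the first `m` steps. -/
noncomputable def whiteDrawLaw (α σ a₀ b₀ m : ℕ) : PMF ℕ :=
  (chainLaw (whiteDrawStep α σ a₀ b₀) 0 m).map fun p => p m

/-- The urn is taken as the image of the counting chain: its composition is a function of time and
count, so nothing has to be divided by `α`. -/
theorem urnLaw_white_eq {α σ a₀ b₀ : ℕ} (hα : α ≤ σ) (hs : 1 ≤ a₀ + b₀) (m : ℕ) :
    ((urnLaw (triangularMatrix α σ) a₀ b₀ m).map fun c => c m 0) =
      (whiteDrawLaw α σ a₀ b₀ m).map fun x => a₀ + x * α := by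
  have := chainLaw_map_lump (step := whiteDrawStep α σ a₀ b₀) (s₀ := 0)
    (step' := fun _ => urnStep (triangularMatrix α σ)) (t₀ := ![a₀, b₀])
    (Inv := fun r x => x ≤ r) le_rfl
    (fun r s h s' hs' => by rcases whiteDrawStep_support hs' with h' | h' <;> omega)
    (triangularState α σ a₀ b₀) 0
    (fun x hx => by
      obtain rfl : x = 0 := by omega
      simp [triangularState])
    (fun m x hx => by
      rw [Nat.zero_add] at hx ⊢
      exact whiteDrawStep_map_state hα hx hs) m
  rw [Nat.zero_add] at this
  rw [urnLaw, ← this, whiteDrawLaw, PMF.map_comp, PMF.map_comp]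
  congr 1
  funext p
  simp [triangularState]

theorem whiteDrawStep_apply {α σ a₀ b₀ m x : ℕ} (hα : α ≤ σ) (hx : x ≤ m)
    (hs : 1 ≤ a₀ + b₀) (y : ℕ) :
    (whiteDrawStep α σ a₀ b₀ m x y).toReal =
      (if y = x + 1 then ((a₀ : ℝ) + x * α) / (a₀ + b₀ + m * σ) else 0) +
      if y = x then ((b₀ : ℝ) + m * σ - x * α) / (a₀ + b₀ + m * σ) else 0 := by
  have hsum := sum_triangularState a₀ b₀ hα hx
  have h : ∑ a, triangularState α σ a₀ b₀ m x a ≠ 0 := by omega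
  have h0 : ((triangularState α σ a₀ b₀ m x 0 : ℕ) : ℝ) = a₀ + x * α := by
    simp [triangularState]
  have h1 : ((triangularState α σ a₀ b₀ m x 1 : ℕ) : ℝ) = b₀ + m * σ - x * α := by
    simp only [triangularState]
    obtain ⟨m, rfl⟩ := Nat.exists_eq_add_of_le hx
    obtain ⟨σ, rfl⟩ := Nat.exists_eq_add_of_le hα
    simp; ring
  unfold whiteDrawStep
  rw [dif_pos h, PMF.map_apply, tsum_fintype, Fin.sum_univ_two, ENNReal.toReal_add]
  · simp only [propTo_apply, hsum, Finset.mem_univ, if_true, one_ne_zero, if_false]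
    congr 1
    · split_ifs
      · rw [ENNReal.toReal_div, ENNReal.toReal_natCast, ENNReal.toReal_natCast, h0]
        push_cast; rfl
      · rfl
    · split_ifs
      · rw [ENNReal.toReal_div, ENNReal.toReal_natCast, ENNReal.toReal_natCast, h1]
        push_cast; rfl
      · rfl
  all_goals split_ifs <;> simp [PMF.apply_ne_top]

theorem whiteDrawLaw_eq_zero {α σ a₀ b₀ m x : ℕ} (hx : m < x) :
    whiteDrawLaw α σ a₀ b₀ m x = 0 := by
  rw [PMF.apply_eq_zero_iff, whiteDrawLaw, PMF.mem_support_map_iff]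
  rintro ⟨p, hp, rfl⟩
  have := chainLaw_support_invariant (Inv := fun r x => x ≤ r) le_rfl
    (fun r s h s' hs' => by rcases whiteDrawStep_support hs' with h' | h' <;> omega) m p hp
  exact absurd hx (not_lt.2 this)

theorem whiteDrawLaw_succ {α σ a₀ b₀ : ℕ} (hα : α ≤ σ) (hs : 1 ≤ a₀ + b₀) (m y : ℕ) :
    (whiteDrawLaw α σ a₀ b₀ (m + 1) y).toReal =
      ∑ x ∈ Finset.range (m + 1), (whiteDrawLaw α σ a₀ b₀ m x).toReal *
      ((if y = x + 1 then ((a₀ : ℝ) + x * α) / (a₀ + b₀ + m * σ) else 0) +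
      if y = x then ((b₀ : ℝ) + m * σ - x * α) / (a₀ + b₀ + m * σ) else 0) := by
  rw [whiteDrawLaw, chainLaw_marginal_succ, PMF.bind_apply]
  change (∑' x, whiteDrawLaw α σ a₀ b₀ m x * _).toReal = _
  rw [tsum_eq_sum (s := Finset.range (m + 1)), ENNReal.toReal_sum]
  · refine Finset.sum_congr rfl fun x hx => ?_
    rw [ENNReal.toReal_mul, whiteDrawStep_apply hα (Nat.lt_succ_iff.1 (Finset.mem_range.1 hx)) hs]
  · exact fun x _ => ENNReal.mul_ne_top (PMF.apply_ne_top _ _) (PMF.apply_ne_top _ _)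
  · intro x hx
    rw [whiteDrawLaw_eq_zero (by simpa using hx), zero_mul]

theorem whiteDrawLaw_succ_zero {α σ a₀ b₀ : ℕ} (hα : α ≤ σ) (hs : 1 ≤ a₀ + b₀) (m : ℕ) :
    (whiteDrawLaw α σ a₀ b₀ (m + 1) 0).toReal =
      (whiteDrawLaw α σ a₀ b₀ m 0).toReal * (((b₀ : ℝ) + m * σ) / (a₀ + b₀ + m * σ)) := by
  rw [whiteDrawLaw_succ hα hs, Finset.sum_eq_single 0]
  · simp
  · intro x _ hx
    simp [hx.symm]
  · simp

theorem whiteDrawLaw_succ_succ {α σ a₀ b₀ : ℕ} (hα : α ≤ σ) (hs : 1 ≤ a₀ + b₀) (m y : ℕ) :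
    (whiteDrawLaw α σ a₀ b₀ (m + 1) (y + 1)).toReal =
      (whiteDrawLaw α σ a₀ b₀ m y).toReal * (((a₀ : ℝ) + y * α) / (a₀ + b₀ + m * σ)) +
      (whiteDrawLaw α σ a₀ b₀ m (y + 1)).toReal *
        (((b₀ : ℝ) + m * σ - (y + 1) * α) / (a₀ + b₀ + m * σ)) := by
  rw [whiteDrawLaw_succ hα hs]
  simp only [mul_add, Finset.sum_add_distrib, add_left_inj, mul_ite, mul_zero]
  rw [Finset.sum_ite_eq, Finset.sum_ite_eq]
  -- Outside the summation range the law vanishes, so the recurrence holds for every `y`, including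
  -- `y ≥ m`.
  congr 1
  · split_ifs with h
    · rfl
    · rw [whiteDrawLaw_eq_zero (by simpa using h)]; simp
  · split_ifs with h
    · push_cast; rfl
    · rw [whiteDrawLaw_eq_zero (by simpa using h)]; simp

/-! ### The explicit distribution -/

/-- Reversing the product gives a rising factorial with base independent of `m`, which gains one
factor per step of the urn. -/
theorem fallingFactorial_shift (m : ℕ) (c : ℝ) :
    fallingFactorial ((m : ℝ) + c - 1) m = ∏ l ∈ Finset.range m, (c + l) := by
  rw [fallingFactorial, ← Finset.prod_range_reflect]
  refine Finset.prod_congr rfl fun l hl => ?_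
  have : l + 1 ≤ m := Finset.mem_range.1 hl
  rw [Nat.sub_sub, Nat.cast_sub (by omega)]
  push_cast; ring

theorem choose_shift_succ (r : ℝ) (x : ℕ) :
    ((x : ℝ) + 1) * Ring.choose (((x + 1 : ℕ) : ℝ) + r - 1) (x + 1) =
      (r + x) * Ring.choose ((x : ℝ) + r - 1) x := by
  have key : ∀ x : ℕ, (x.factorial : ℝ) * Ring.choose ((x : ℝ) + r - 1) x =
      (ascPochhammer ℝ x).eval r := by
    intro x
    have : Ring.choose ((x : ℝ) + r - 1) x = Ring.multichoose r x := by
      rw [Ring.choose]; congr 1; ring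
    rw [this, ← nsmul_eq_mul, Ring.factorial_nsmul_multichoose_eq_ascPochhammer,
      Polynomial.ascPochhammer_smeval_eq_eval]
  have h1 := key (x + 1)
  rw [ascPochhammer_succ_eval, ← key x, Nat.factorial_succ] at h1
  have h2 : (x.factorial : ℝ) ≠ 0 := by positivity
  apply mul_left_cancel₀ h2
  push_cast at h1 ⊢
  linear_combination h1

/-- Write `c - u = (c - (y + 1)) + (y + 1 - u)` and absorb the second part by `(y + 1 - u) * C(y +
1, u) = (y + 1) * C(y, u)`. The two sums correspond to a black and a white last draw. -/
theorem alternating_sum_recurrence (g : ℕ → ℝ) (c : ℝ) (y : ℕ) :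
    ∑ u ∈ Finset.range (y + 1 + 1), (-1 : ℝ) ^ u * ((y + 1).choose u : ℝ) * (g u * (c - u)) =
      (∑ u ∈ Finset.range (y + 1 + 1), (-1 : ℝ) ^ u * ((y + 1).choose u : ℝ) * g u) *
        (c - (y + 1)) +
      (y + 1) * ∑ u ∈ Finset.range (y + 1), (-1 : ℝ) ^ u * (y.choose u : ℝ) * g u := by
  have h : ∑ u ∈ Finset.range (y + 1), (-1 : ℝ) ^ u * (y.choose u : ℝ) * g u =
      ∑ u ∈ Finset.range (y + 1 + 1), (-1 : ℝ) ^ u * (y.choose u : ℝ) * g u := by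
    rw [Finset.sum_range_succ _ (y + 1)]; simp
  rw [h, Finset.sum_mul, Finset.mul_sum, ← Finset.sum_add_distrib]
  refine Finset.sum_congr rfl fun u hu => ?_
  have hu' : u ≤ y + 1 := Nat.lt_succ_iff.1 (Finset.mem_range.1 hu)
  have h2 : ((y : ℝ) + 1) * y.choose u = (y + 1).choose u * ((y : ℝ) + 1 - u) := by
    have h3 := Nat.choose_mul_succ_eq y u
    have h4 : ((y.choose u * (y + 1) : ℕ) : ℝ) = (((y + 1).choose u * (y + 1 - u) : ℕ) : ℝ) := by
      rw [h3]
    rw [Nat.cast_mul, Nat.cast_mul, Nat.cast_sub hu'] at h4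
    push_cast at h4
    linarith
  linear_combination -(-1 : ℝ) ^ u * g u * h2

theorem whiteDrawLaw_apply {α σ a₀ b₀ : ℕ} (hα1 : 1 ≤ α) (hα : α ≤ σ) (hs : 1 ≤ a₀ + b₀)
    (m : ℕ) : ∀ x : ℕ, (whiteDrawLaw α σ a₀ b₀ m x).toReal =
      Ring.choose ((x : ℝ) + (a₀ : ℝ) / (α : ℝ) - 1) x *
        ∑ u ∈ Finset.range (x + 1), (-1 : ℝ) ^ u * (x.choose u : ℝ) *
          ∏ l ∈ Finset.range m, ((((b₀ : ℝ) - α * u) / σ + l) / (((a₀ : ℝ) + b₀) / σ + l)) := by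
  have hα0 : (α : ℝ) ≠ 0 := by positivity
  have hσ0 : (σ : ℝ) ≠ 0 := by
    have : 0 < σ := by omega
    positivity
  induction m with
  | zero =>
    intro x
    simp only [Finset.range_zero, Finset.prod_empty, mul_one]
    -- At time `0` the products are empty, and the alternating binomial sum is the point mass at
    -- `0`.
    have h1 : ∑ u ∈ Finset.range (x + 1), (-1 : ℝ) ^ u * (x.choose u : ℝ) =
        if x = 0 then 1 else 0 := by
      have := Int.alternating_sum_range_choose (n := x)
      have h2 := congrArg (fun z : ℤ => (z : ℝ)) this
      push_cast at h2
      exact h2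
    rw [h1, whiteDrawLaw, chainLaw, PMF.pure_map, PMF.pure_apply]
    split_ifs with h
    · subst h; simp
    · simp
  | succ m ih =>
    have hs' : (0 : ℝ) < a₀ + b₀ + m * σ := by
      have : (1 : ℝ) ≤ a₀ + b₀ := by exact_mod_cast hs
      positivity
    -- The new factor in the form `(c - u) * const` that `alternating_sum_recurrence` expects.
    have hfac : ∀ u : ℕ, (((b₀ : ℝ) - α * u) / σ + m) / (((a₀ : ℝ) + b₀) / σ + m) =
        (((b₀ : ℝ) + m * σ) / α - u) * (α / (a₀ + b₀ + m * σ)) := by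
      intro u
      have : ((a₀ : ℝ) + b₀) / σ + m = (a₀ + b₀ + m * σ) / σ := by field_simp
      rw [this]
      field_simp
      ring
    intro x
    simp only [Finset.prod_range_succ, hfac]
    cases x with
    | zero =>
      rw [whiteDrawLaw_succ_zero hα hs, ih 0]
      simp only [zero_add, Finset.range_one, Finset.sum_singleton, Nat.cast_zero, mul_zero, sub_zero]
      field_simp
    | succ y =>
      rw [whiteDrawLaw_succ_succ hα hs, ih y, ih (y + 1)]
      set g : ℕ → ℝ := fun u =>
        ∏ l ∈ Finset.range m, ((((b₀ : ℝ) - α * u) / σ + l) / (((a₀ : ℝ) + b₀) / σ + l)) with hg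
      have h1 := alternating_sum_recurrence g (((b₀ : ℝ) + m * σ) / α) y
      have h2 := choose_shift_succ ((a₀ : ℝ) / α) y
      simp only [← mul_assoc] at h1 ⊢
      rw [← Finset.sum_mul, h1]
      set A := ∑ u ∈ Finset.range (y + 1 + 1), (-1 : ℝ) ^ u * ((y + 1).choose u : ℝ) * g u
      set B := ∑ u ∈ Finset.range (y + 1), (-1 : ℝ) ^ u * (y.choose u : ℝ) * g u
      set c := Ring.choose ((y : ℝ) + (a₀ : ℝ) / α - 1) y
      set d := Ring.choose (((y + 1 : ℕ) : ℝ) + (a₀ : ℝ) / α - 1) (y + 1)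
      have h3 : c * ((a₀ : ℝ) + y * α) = α * ((y + 1) * d) := by
        rw [h2]; field_simp
      field_simp
      linear_combination B * h3

theorem urnLaw_white_apply {α σ a₀ b₀ : ℕ} (hα1 : 1 ≤ α) (hα : α ≤ σ) (hs : 1 ≤ a₀ + b₀)
    (m x : ℕ) :
    (((urnLaw (triangularMatrix α σ) a₀ b₀ m).map fun c => c m 0) (a₀ + x * α)).toReal =
      Ring.choose ((x : ℝ) + (a₀ : ℝ) / (α : ℝ) - 1) x *
        ∑ u ∈ Finset.range (x + 1), (-1 : ℝ) ^ u * (x.choose u : ℝ) *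
          (fallingFactorial ((m : ℝ) + ((b₀ : ℝ) - (α : ℝ) * (u : ℝ)) / (σ : ℝ) - 1) m /
            fallingFactorial ((m : ℝ) + ((a₀ : ℝ) + (b₀ : ℝ)) / (σ : ℝ) - 1) m) := by
  have hinj : Function.Injective fun x : ℕ => a₀ + x * α := fun x y h =>
    Nat.eq_of_mul_eq_mul_right (by omega : 0 < α) (Nat.add_left_cancel h)
  rw [urnLaw_white_eq hα hs, PMF.map_apply_of_injective _ hinj x, whiteDrawLaw_apply hα1 hα hs]
  simp only [fallingFactorial_shift, Finset.prod_div_distrib]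

/-! ### One step of the graph process -/

/-- A given element lies in a fraction `q / |s|` of the `q`-subsets; those avoiding it are the
`q`-subsets of `s.erase i`. -/
theorem card_filter_mem_powersetCard {A : Type*} [DecidableEq A] (s : Finset A) {i : A} (hi : i ∈ s) {q : ℕ}
    (hq : q ≤ s.card) :
    ((s.powersetCard q).filter (i ∈ ·)).card * s.card = s.card.choose q * q := by
  have h1 : (s.powersetCard q).filter (i ∉ ·) = (s.erase i).powersetCard q := by
    ext T
    simp only [Finset.mem_filter, Finset.mem_powersetCard, Finset.subset_erase]
    tauto
  have h2 := Finset.card_filter_add_card_filter_not (s := s.powersetCard q) (i ∈ ·)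
  rw [h1, Finset.card_powersetCard, Finset.card_powersetCard, Finset.card_erase_of_mem hi] at h2
  obtain ⟨d, hd⟩ : ∃ d, s.card = d + 1 := ⟨s.card - 1, by
    have := Finset.card_pos.2 ⟨i, hi⟩
    omega⟩
  rw [hd] at h2 hq ⊢
  have h3 := Nat.choose_mul_succ_eq d q
  rw [Nat.add_sub_cancel] at h2
  obtain ⟨e, he⟩ := Nat.exists_eq_add_of_le hq
  rw [show d + 1 - q = e by omega] at h3
  have h4 := congrArg (· * (d + 1)) h2
  rw [add_mul, h3] at h4
  have h5 : (d + 1).choose q * (d + 1) = (d + 1).choose q * q + (d + 1).choose q * e := by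
    rw [← mul_add, ← he]
  omega

theorem uniformOfFinset_map_apply_true {A : Type*} (F : Finset A) (h : F.Nonempty)
    (e : A → Bool) : ((PMF.uniformOfFinset F h).map e) true =
      ((F.filter fun a => e a = true).card : ℝ≥0∞) / F.card := by
  rw [PMF.map_apply, tsum_eq_sum (s := F), div_eq_mul_inv, ← nsmul_eq_mul, ← Finset.sum_const,
    Finset.sum_filter]
  · refine Finset.sum_congr rfl fun a ha => ?_
    rw [PMF.uniformOfFinset_apply_of_mem h ha]
    cases e a <;> simp
  · intro a ha
    rw [PMF.uniformOfFinset_apply_of_notMem h ha, ite_self]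

/-- The law of the set of vertices to which the new vertex is joined. -/
noncomputable def attachSetLaw (k t : ℕ) (G : SimpleGraph ℕ)
    (h : ∑ v ∈ Finset.Icc 1 t, deg t G v ≠ 0) : PMF (Finset ℕ) :=
  (propTo (Finset.Icc 1 t) (deg t G) h).bind fun w =>
    if h' : (Finset.powersetCard (k - 1) (nbrs t G w)).Nonempty then
      (PMF.uniformOfFinset _ h').map (insert w)
    else PMF.pure ∅

/-- Makes the default value `∅` in `attachSetLaw` match the default `G` in `graphStep`. -/
theorem attach_empty (G : SimpleGraph ℕ) (v : ℕ) : attach G v ∅ = G := by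
  ext a b
  simp [attach]

theorem graphStep_eq (k t : ℕ) (G : SimpleGraph ℕ)
    (h : ∑ v ∈ Finset.Icc 1 t, deg t G v ≠ 0) :
    graphStep k t G = (attachSetLaw k t G h).map (attach G (t + 1)) := by
  rw [graphStep, dif_pos h, attachSetLaw, PMF.map_bind]
  congr 1
  funext w
  split_ifs
  · rw [PMF.map_comp]; rfl
  · rw [PMF.pure_map, attach_empty]

/-- The properties that the graphs of the process have at time `t`. -/
structure GraphInv (k j t : ℕ) (G : SimpleGraph ℕ) : Prop where
  mem_of_adj : ∀ a b, G.Adj a b → a ∈ Finset.Icc 1 t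
  le_deg : ∀ v ∈ Finset.Icc 1 t, k - 1 ≤ deg t G v
  sum_deg : ∑ v ∈ Finset.Icc 1 t, deg t G v = j * (j - 1) + 2 * k * (t - j)
  deg_seed : t = j → ∀ v ∈ Finset.Icc 1 j, deg t G v = j - 1
  deg_last : j < t → deg t G t = k

theorem graphInv_seedGraph {k j : ℕ} (hkj : k ≤ j) : GraphInv k j j (seedGraph j) := by
  have hdeg : ∀ v ∈ Finset.Icc 1 j, deg j (seedGraph j) v = j - 1 := by
    intro v hv
    have : nbrs j (seedGraph j) v = (Finset.Icc 1 j).erase v := by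
      ext u
      rw [nbrs, Finset.mem_filter, Finset.mem_erase]
      change _ ∧ v ≠ u ∧ _ ↔ _
      rw [ne_comm]
      tauto
    rw [deg, this, Finset.card_erase_of_mem hv]; simp
  exact {
    mem_of_adj := fun a b h => h.2.1
    -- Equality occurs when `j = k`, so the invariant cannot ask for degree `k`.
    le_deg := fun v hv => by rw [hdeg v hv]; omega
    sum_deg := by rw [Finset.sum_congr rfl hdeg]; simp
    deg_seed := fun _ => hdeg
    deg_last := fun h => absurd h (lt_irrefl _) }

section Step

variable {k j t : ℕ} {G : SimpleGraph ℕ}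

theorem nbrs_attach_old (hG : GraphInv k j t G) {W : Finset ℕ} {i : ℕ}
    (hi : i ∈ Finset.Icc 1 t) :
    nbrs (t + 1) (attach G (t + 1) W) i =
      if i ∈ W then insert (t + 1) (nbrs t G i) else nbrs t G i := by
  have hit := Finset.mem_Icc.1 hi
  have h1 : ∀ u, G.Adj i u → 1 ≤ u ∧ u ≤ t := fun u hu =>
    Finset.mem_Icc.1 (hG.mem_of_adj _ _ hu.symm)
  ext u
  have h2 : u ∈ nbrs (t + 1) (attach G (t + 1) W) i ↔
      (1 ≤ u ∧ u ≤ t + 1) ∧ (G.Adj i u ∨ i ≠ u ∧ (i = t + 1 ∧ u ∈ W ∨ u = t + 1 ∧ i ∈ W)) := by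
    simp [nbrs, attach]
  have h3 : u ∈ nbrs t G i ↔ (1 ≤ u ∧ u ≤ t) ∧ G.Adj i u := by simp [nbrs]
  have h4 := h1 u
  split_ifs with hW
  · rw [Finset.mem_insert, h2, h3]
    constructor
    · rintro ⟨-, h | ⟨-, h | h⟩⟩
      · exact Or.inr ⟨h4 h, h⟩
      · omega
      · exact Or.inl h.1
    · rintro (rfl | h)
      · exact ⟨⟨by omega, le_rfl⟩, Or.inr ⟨by omega, Or.inr ⟨rfl, hW⟩⟩⟩
      · exact ⟨⟨h.1.1, by omega⟩, Or.inl h.2⟩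
  · rw [h2, h3]
    constructor
    · rintro ⟨-, h | ⟨-, h | h⟩⟩
      · exact ⟨h4 h, h⟩
      · omega
      · exact absurd h.2 hW
    · rintro h
      exact ⟨⟨h.1.1, by omega⟩, Or.inl h.2⟩

theorem nbrs_attach_new (hG : GraphInv k j t G) {W : Finset ℕ} (hW : W ⊆ Finset.Icc 1 t) :
    nbrs (t + 1) (attach G (t + 1) W) (t + 1) = W := by
  ext u
  have h1 : ¬ G.Adj (t + 1) u := fun h => by
    have := Finset.mem_Icc.1 (hG.mem_of_adj _ _ h)
    omega
  have h2 : u ∈ nbrs (t + 1) (attach G (t + 1) W) (t + 1) ↔ (1 ≤ u ∧ u ≤ t + 1) ∧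
      (G.Adj (t + 1) u ∨ t + 1 ≠ u ∧ (t + 1 = t + 1 ∧ u ∈ W ∨ u = t + 1 ∧ t + 1 ∈ W)) := by
    simp [nbrs, attach]
  rw [h2]
  constructor
  · rintro ⟨-, h | ⟨h, h' | h'⟩⟩
    · exact absurd h h1
    · exact h'.2
    · exact absurd h'.1.symm h
  · intro h
    have := Finset.mem_Icc.1 (hW h)
    exact ⟨by omega, Or.inr ⟨by omega, Or.inl ⟨rfl, h⟩⟩⟩

theorem deg_attach_old (hG : GraphInv k j t G) {W : Finset ℕ} {i : ℕ}
    (hi : i ∈ Finset.Icc 1 t) :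
    deg (t + 1) (attach G (t + 1) W) i = deg t G i + if i ∈ W then 1 else 0 := by
  rw [deg, nbrs_attach_old hG hi]
  split_ifs
  · rw [Finset.card_insert_of_notMem (by simp [nbrs])]; rfl
  · rfl

theorem sum_deg_ne_zero (hG : GraphInv k j t G) (hk : 2 ≤ k) (hkj : k ≤ j) :
    ∑ v ∈ Finset.Icc 1 t, deg t G v ≠ 0 := by
  rw [hG.sum_deg]
  have : 0 < j * (j - 1) := Nat.mul_pos (by omega) (by omega)
  omega

theorem powersetCard_nbrs_nonempty (hG : GraphInv k j t G) {w : ℕ} (hw : w ∈ Finset.Icc 1 t) :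
    (Finset.powersetCard (k - 1) (nbrs t G w)).Nonempty :=
  Finset.powersetCard_nonempty.2 (hG.le_deg w hw)

theorem attachSetLaw_support (hG : GraphInv k j t G) (hk : 2 ≤ k)
    (h : ∑ v ∈ Finset.Icc 1 t, deg t G v ≠ 0) {W : Finset ℕ}
    (hW : W ∈ (attachSetLaw k t G h).support) : W ⊆ Finset.Icc 1 t ∧ W.card = k := by
  rw [attachSetLaw, PMF.mem_support_bind_iff] at hW
  obtain ⟨w, hw, hW⟩ := hW
  have hw' : w ∈ Finset.Icc 1 t := by
    by_contra hn
    rw [PMF.mem_support_iff, propTo_apply, if_neg hn] at hw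
    exact hw rfl
  rw [dif_pos (powersetCard_nbrs_nonempty hG hw'), PMF.mem_support_map_iff] at hW
  obtain ⟨T, hT, rfl⟩ := hW
  rw [PMF.mem_support_uniformOfFinset_iff, Finset.mem_powersetCard] at hT
  refine ⟨Finset.insert_subset hw' (hT.1.trans (Finset.filter_subset _ _)), ?_⟩
  rw [Finset.card_insert_of_notMem, hT.2]
  · omega
  · intro hwT
    have := hT.1 hwT
    simp [nbrs] at this

theorem GraphInv.step (hG : GraphInv k j t G) (hk : 2 ≤ k) (hkj : k ≤ j) (hjt : j ≤ t) :
    ∀ G' ∈ (graphStep k t G).support, GraphInv k j (t + 1) G' := by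
  intro G' hG'
  have h := sum_deg_ne_zero hG hk hkj
  rw [graphStep_eq k t G h, PMF.mem_support_map_iff] at hG'
  obtain ⟨W, hW, rfl⟩ := hG'
  obtain ⟨hW, hc⟩ := attachSetLaw_support hG hk h hW
  have hnew : deg (t + 1) (attach G (t + 1) W) (t + 1) = k := by
    rw [deg, nbrs_attach_new hG hW, hc]
  refine ⟨?_, ?_, ?_, by omega, fun _ => hnew⟩
  · intro a b hab
    rw [Finset.mem_Icc]
    simp only [attach, SimpleGraph.sup_adj, SimpleGraph.fromRel_adj] at hab
    rcases hab with hab | ⟨-, ⟨rfl, -⟩ | ⟨-, ha⟩⟩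
    · have := Finset.mem_Icc.1 (hG.mem_of_adj _ _ hab)
      omega
    · omega
    · have := Finset.mem_Icc.1 (hW ha)
      omega
  · intro v hv
    rcases eq_or_ne v (t + 1) with rfl | hne
    · rw [hnew]; omega
    · have hv' : v ∈ Finset.Icc 1 t := by
        rw [Finset.mem_Icc] at hv ⊢; omega
      rw [deg_attach_old hG hv']
      exact (hG.le_deg v hv').trans (Nat.le_add_right _ _)
  -- The new vertex has degree `k` and `k` old degrees rise by one: `2k` in total.
  · rw [Finset.sum_Icc_succ_top (by omega), hnew,
      Finset.sum_congr rfl fun v hv => deg_attach_old hG hv, Finset.sum_add_distrib, hG.sum_deg,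
      Finset.sum_ite_mem, Finset.inter_eq_right.2 hW, Finset.sum_const, hc, Nat.sub_add_comm hjt,
      smul_eq_mul]
    ring

/-- Conditionally on `w` being the vertex chosen first, the probability that `i` becomes a
neighbour of the new vertex, multiplied by the degree of `w`. -/
theorem deg_mul_prob_mem (hG : GraphInv k j t G) {w i : ℕ} (hw : w ∈ Finset.Icc 1 t)
    (hi : i ∈ Finset.Icc 1 t) :
    (deg t G w : ℝ≥0∞) * (((PMF.uniformOfFinset _ (powersetCard_nbrs_nonempty hG hw)).map
        fun T => decide (i ∈ insert w T)) true) =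
      (((if w = i then deg t G i else 0) + if w ∈ nbrs t G i then k - 1 else 0 : ℕ) : ℝ≥0∞) := by
  rw [uniformOfFinset_map_apply_true]
  have hcard : (Finset.powersetCard (k - 1) (nbrs t G w)).card ≠ 0 :=
    (Finset.card_pos.2 (powersetCard_nbrs_nonempty hG hw)).ne'
  have hcard' : ((Finset.powersetCard (k - 1) (nbrs t G w)).card : ℝ≥0∞) ≠ 0 := by
    exact_mod_cast hcard
  simp only [decide_eq_true_eq, Finset.mem_insert]
  rcases eq_or_ne w i with rfl | hne
  · simp only [true_or, Finset.filter_true]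
    rw [ENNReal.div_self hcard' (ENNReal.natCast_ne_top _)]
    simp [nbrs]
  · simp only [hne, hne.symm, false_or, if_false, zero_add]
    by_cases hadj : G.Adj i w
    · have hiw : i ∈ nbrs t G w := Finset.mem_filter.2 ⟨hi, hadj.symm⟩
      have hwi : w ∈ nbrs t G i := Finset.mem_filter.2 ⟨hw, hadj⟩
      -- `i` lies in a fraction `(k - 1) / deg w` of the sets `T`; the weight `deg w` cancels the
      -- denominator.
      have := card_filter_mem_powersetCard (nbrs t G w) hiw (hG.le_deg w hw)
      rw [if_pos hwi, ← mul_div_assoc, ← Nat.cast_mul, mul_comm, deg, this,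
        Finset.card_powersetCard, Nat.cast_mul, mul_comm]
      rw [Finset.card_powersetCard] at hcard'
      exact ENNReal.mul_div_cancel_right hcard' (ENNReal.natCast_ne_top _)
    · have hiw : i ∉ nbrs t G w := fun h => hadj (Finset.mem_filter.1 h).2.symm
      have hwi : w ∉ nbrs t G i := fun h => hadj (Finset.mem_filter.1 h).2
      have : (Finset.powersetCard (k - 1) (nbrs t G w)).filter (i ∈ ·) = ∅ :=
        Finset.filter_eq_empty_iff.2 fun T hT hiT => hiw ((Finset.mem_powersetCard.1 hT).1 hiT)
      rw [if_neg hwi, this]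
      simp

/-- The choice `w = i` contributes `deg i`, and each of the `deg i` neighbours contributes `k - 1`.
-/
theorem attachSetLaw_prob_mem (hG : GraphInv k j t G) (hk : 2 ≤ k)
    (h : ∑ v ∈ Finset.Icc 1 t, deg t G v ≠ 0) {i : ℕ} (hi : i ∈ Finset.Icc 1 t) :
    ((attachSetLaw k t G h).map fun W => decide (i ∈ W)) true =
      ((k * deg t G i : ℕ) : ℝ≥0∞) / ((∑ v ∈ Finset.Icc 1 t, deg t G v : ℕ) : ℝ≥0∞) := by
  rw [attachSetLaw, PMF.map_bind, PMF.bind_apply, tsum_eq_sum (s := Finset.Icc 1 t)]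
  · have hterm : ∀ w ∈ Finset.Icc 1 t, (propTo (Finset.Icc 1 t) (deg t G) h w *
        (PMF.map (fun W => decide (i ∈ W))
          (if h' : (Finset.powersetCard (k - 1) (nbrs t G w)).Nonempty then
            (PMF.uniformOfFinset _ h').map (insert w) else PMF.pure ∅)) true) =
        (((if w = i then deg t G i else 0) + if w ∈ nbrs t G i then k - 1 else 0 : ℕ) : ℝ≥0∞) *
          ((∑ v ∈ Finset.Icc 1 t, deg t G v : ℕ) : ℝ≥0∞)⁻¹ := by
      intro w hw
      rw [dif_pos (powersetCard_nbrs_nonempty hG hw), PMF.map_comp, propTo_apply, if_pos hw,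
        ← deg_mul_prob_mem hG hw hi, div_eq_mul_inv, mul_right_comm]
      rfl
    rw [Finset.sum_congr rfl hterm, ← Finset.sum_mul, ← Nat.cast_sum, div_eq_mul_inv]
    congr 2
    rw [Finset.sum_add_distrib, Finset.sum_ite_eq' (Finset.Icc 1 t) i, if_pos hi,
      Finset.sum_ite_mem, Finset.inter_eq_right.2 (show nbrs t G i ⊆ _ from Finset.filter_subset _ _), Finset.sum_const,
      smul_eq_mul]
    obtain ⟨k, rfl⟩ := Nat.exists_eq_add_of_le hk
    rw [show 2 + k - 1 = 1 + k by omega]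
    simp only [deg]
    ring
  · intro w hw
    rw [propTo_apply, if_neg hw, zero_mul]

/-- Each neighbour of `i` has degree at least `k - 1`; add these to the degree of `i`. This keeps
the number of black balls from being truncated. -/
theorem mul_deg_le_sum (hG : GraphInv k j t G) (hk : 2 ≤ k) {i : ℕ} (hi : i ∈ Finset.Icc 1 t) :
    k * deg t G i ≤ ∑ v ∈ Finset.Icc 1 t, deg t G v := by
  have hni : i ∉ nbrs t G i := by simp [nbrs]
  have hsub : insert i (nbrs t G i) ⊆ Finset.Icc 1 t :=
    Finset.insert_subset hi (Finset.filter_subset _ _)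
  calc k * deg t G i = deg t G i + ∑ _v ∈ nbrs t G i, (k - 1) := by
        obtain ⟨k, rfl⟩ := Nat.exists_eq_add_of_le hk
        rw [Finset.sum_const, smul_eq_mul, show 2 + k - 1 = 1 + k by omega, deg]
        ring
    _ ≤ deg t G i + ∑ v ∈ nbrs t G i, deg t G v :=
        Nat.add_le_add_left (Finset.sum_le_sum fun v hv =>
          hG.le_deg v (Finset.filter_subset _ _ hv)) _
    _ = ∑ v ∈ insert i (nbrs t G i), deg t G v := (Finset.sum_insert hni).symm
    _ ≤ _ := Finset.sum_le_sum_of_subset hsub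

theorem graphStep_map_deg (hG : GraphInv k j t G) (hk : 2 ≤ k) (hkj : k ≤ j) {i D : ℕ}
    (hi : i ∈ Finset.Icc 1 t) (hD : ∑ v ∈ Finset.Icc 1 t, deg t G v = D) :
    (graphStep k t G).map
        (fun G' => ![k * deg (t + 1) G' i, D + 2 * k - k * deg (t + 1) G' i]) =
      urnStep (triangularMatrix k (2 * k)) ![k * deg t G i, D - k * deg t G i] := by
  have h := sum_deg_ne_zero hG hk hkj
  have hle := mul_deg_le_sum hG hk hi
  rw [hD] at hle
  have hsum : ∑ a, ![k * deg t G i, D - k * deg t G i] a = D := by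
    simp [Fin.sum_univ_two, Nat.add_sub_cancel' hle]
  have hsum0 : ∑ a, ![k * deg t G i, D - k * deg t G i] a ≠ 0 := by
    rw [hsum, ← hD]; exact h
  -- Each step is decided by one bit: whether `i` is joined, or whether a white ball is drawn. `g`
  -- sends it to the next composition, so only the probability of `true` has to be compared.
  set g : Bool → Fin 2 → ℕ := fun b =>
    ![k * (deg t G i + if b then 1 else 0), D + 2 * k - k * (deg t G i + if b then 1 else 0)] with hg
  have hL : (graphStep k t G).map
        (fun G' => ![k * deg (t + 1) G' i, D + 2 * k - k * deg (t + 1) G' i]) =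
      ((attachSetLaw k t G h).map fun W => decide (i ∈ W)).map g := by
    rw [graphStep_eq k t G h, PMF.map_comp, PMF.map_comp]
    congr 1
    funext W
    simp only [Function.comp_apply, deg_attach_old hG hi, hg, decide_eq_true_eq]
  have hR : urnStep (triangularMatrix k (2 * k)) ![k * deg t G i, D - k * deg t G i] =
      ((propTo Finset.univ _ hsum0).map fun a => decide (a = 0)).map g := by
    rw [urnStep, dif_pos hsum0, PMF.map_comp]
    congr 1
    funext a b
    fin_cases a <;> fin_cases b <;> simp [triangularMatrix, hg, mul_add] <;> omega
  rw [hL, hR]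
  congr 1
  apply PMF.ext_of_apply_true
  rw [attachSetLaw_prob_mem hG hk h hi, PMF.map_apply, tsum_fintype, Fin.sum_univ_two]
  simp only [propTo_apply, hsum, hD]
  simp

end Step

/-! ### Degrees in the graph process -/

/-- Treats both kinds of vertices: `r₀ = 0`, `d₀ = j - 1` for the seed, and `r₀ = i - j`, `d₀ = k`
for later ones. The urn starts deterministically because `hd` fixes the degree at time `j + r₀`. -/
theorem graphLaw_map_deg {k j i r₀ d₀ : ℕ} (hk : 2 ≤ k) (hkj : k ≤ j) (hi : 1 ≤ i)
    (hi' : i ≤ j + r₀) (hd : ∀ G, GraphInv k j (j + r₀) G → deg (j + r₀) G i = d₀) (m : ℕ) :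
    ((graphLaw k j (j + (r₀ + m))).map fun p => fun r : Fin (m + 1) =>
        k * deg (j + r₀ + (r : ℕ)) (p (r₀ + (r : ℕ))) i) =
      (urnLaw (triangularMatrix k (2 * k)) (k * d₀)
        (j * (j - 1) + 2 * k * r₀ - k * d₀) m).map fun c => fun r : Fin (m + 1) => c (r : ℕ) 0 := by
  have hmem : ∀ r, i ∈ Finset.Icc 1 (j + (r₀ + r)) := fun r => Finset.mem_Icc.2 ⟨hi, by omega⟩
  have := chainLaw_map_lump (step := fun r => graphStep k (j + r)) (s₀ := seedGraph j)
    (step' := fun _ => urnStep (triangularMatrix k (2 * k)))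
    (t₀ := ![k * d₀, j * (j - 1) + 2 * k * r₀ - k * d₀])
    (Inv := fun r G => GraphInv k j (j + r) G) (graphInv_seedGraph hkj)
    (fun r G hG => hG.step hk hkj (Nat.le_add_right _ _))
    (fun r G => ![k * deg (j + (r₀ + r)) G i,
      j * (j - 1) + 2 * k * (r₀ + r) - k * deg (j + (r₀ + r)) G i]) r₀
    (fun G hG => by simp only [Nat.add_zero, hd G hG])
    (fun r G hG => by
      have := graphStep_map_deg hG hk hkj (hmem r) hG.sum_deg
      rw [Nat.add_sub_cancel_left] at this
      rw [← this]
      congr 1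
      funext G'
      rw [show j + (r₀ + (r + 1)) = j + (r₀ + r) + 1 by ring,
        show j * (j - 1) + 2 * k * (r₀ + (r + 1)) =
          j * (j - 1) + 2 * k * (r₀ + r) + 2 * k by ring]) m
  rw [graphLaw, Nat.add_sub_cancel_left, urnLaw, ← this, PMF.map_comp]
  congr 1
  funext p r
  simp [Nat.lt_succ_iff.1 r.2, add_assoc]

/-- The final marginal of the path identity; multiplication by `k` is injective, and `a₀ / α = d₀`.
-/
theorem degreeLaw_apply {k j i r₀ d₀ : ℕ} (hk : 2 ≤ k) (hkj : k ≤ j) (hi : 1 ≤ i)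
    (hi' : i ≤ j + r₀) (hd : ∀ G, GraphInv k j (j + r₀) G → deg (j + r₀) G i = d₀)
    (hle : k * d₀ ≤ j * (j - 1) + 2 * k * r₀) (m x : ℕ) :
    (degreeLaw k j (j + (r₀ + m)) i (d₀ + x)).toReal =
      Ring.choose ((x : ℝ) + d₀ - 1) x *
        ∑ u ∈ Finset.range (x + 1), (-1 : ℝ) ^ u * (x.choose u : ℝ) *
          (fallingFactorial ((m : ℝ) +
              ((j : ℝ) * (j - 1) + 2 * k * r₀ - k * d₀ - k * u) / (2 * k) - 1) m /
            fallingFactorial ((m : ℝ) + ((j : ℝ) * (j - 1) + 2 * k * r₀) / (2 * k) - 1) m) := by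
  have hk0 : (k : ℝ) ≠ 0 := by
    have : 0 < k := by omega
    positivity
  have hlaw := congrArg (PMF.map fun q : Fin (m + 1) → ℕ => q (Fin.last m))
    (graphLaw_map_deg hk hkj hi hi' hd m)
  rw [PMF.map_comp, PMF.map_comp] at hlaw
  have hlaw' : (degreeLaw k j (j + (r₀ + m)) i).map (fun d => k * d) =
      (urnLaw (triangularMatrix k (2 * k)) (k * d₀)
        (j * (j - 1) + 2 * k * r₀ - k * d₀) m).map fun c => c m 0 := by
    rw [degreeLaw, PMF.map_comp]
    convert hlaw using 2
    · funext p
      simp [add_assoc]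
    · rfl
  have hinj : Function.Injective fun d : ℕ => k * d := fun a b h =>
    Nat.eq_of_mul_eq_mul_left (by omega : 0 < k) h
  have hpos : 0 < j * (j - 1) := Nat.mul_pos (by omega) (by omega)
  have hb : ((j * (j - 1) + 2 * k * r₀ - k * d₀ : ℕ) : ℝ) =
      (j : ℝ) * (j - 1) + 2 * k * r₀ - k * d₀ := by
    rw [Nat.cast_sub hle]
    push_cast [Nat.cast_sub (by omega : 1 ≤ j)]
    ring
  rw [← PMF.map_apply_of_injective _ hinj (d₀ + x), hlaw',
    show k * (d₀ + x) = k * d₀ + x * k by ring,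
    urnLaw_white_apply (by omega) (by omega) (by omega), hb]
  push_cast
  rw [mul_div_cancel_left₀ _ hk0]
  simp only [add_sub_cancel]

theorem choose_cast_shift (x d : ℕ) (hd : 1 ≤ d) :
    Ring.choose ((x : ℝ) + d - 1) x = ((x + d - 1).choose x : ℝ) := by
  rw [← Ring.choose_natCast, Nat.cast_sub (by omega)]
  push_cast; rfl

theorem mainTheorem2 :
    -- the number of white balls in a triangular urn
    (∀ (α σ a₀ b₀ : ℕ), 1 ≤ α → α ≤ σ → 1 ≤ a₀ + b₀ → ∀ m x : ℕ,
      (((urnLaw (triangularMatrix α σ) a₀ b₀ m).map fun c => c m 0) (a₀ + x * α)).toReal =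
        Ring.choose ((x : ℝ) + (a₀ : ℝ) / (α : ℝ) - 1) x *
          ∑ u ∈ Finset.range (x + 1), (-1 : ℝ) ^ u * (x.choose u : ℝ) *
            (fallingFactorial ((m : ℝ) + ((b₀ : ℝ) - (α : ℝ) * (u : ℝ)) / (σ : ℝ) - 1) m /
              fallingFactorial ((m : ℝ) + ((a₀ : ℝ) + (b₀ : ℝ)) / (σ : ℝ) - 1) m)) ∧
    ∀ (k j n i : ℕ), 2 ≤ k → k ≤ j → j ≤ n →
      -- a vertex of the seed: evolution and exact distribution of its degree
      (1 ≤ i → i ≤ j →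
        ((graphLaw k j n).map fun p => fun r : Fin (n - j + 1) =>
            k * deg (j + (r : ℕ)) (p (r : ℕ)) i) =
          ((urnLaw (triangularMatrix k (2 * k)) (k * (j - 1)) ((j - k) * (j - 1)) (n - j)).map
            fun c => fun r : Fin (n - j + 1) => c (r : ℕ) 0) ∧
        ∀ x : ℕ,
          (degreeLaw k j n i (j - 1 + x)).toReal =
            ((x + j - 2).choose x : ℝ) *
              ∑ u ∈ Finset.range (x + 1), (-1 : ℝ) ^ u * (x.choose u : ℝ) *
                (fallingFactorial ((n : ℝ) - (j : ℝ) +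
                    (((j : ℝ) - (k : ℝ)) * ((j : ℝ) - 1) - (k : ℝ) * (u : ℝ)) / (2 * (k : ℝ)) - 1)
                    (n - j) /
                  fallingFactorial ((n : ℝ) - (j : ℝ) +
                    (j : ℝ) * ((j : ℝ) - 1) / (2 * (k : ℝ)) - 1) (n - j))) ∧
      -- a later vertex: evolution and exact distribution of its degree
      (j < i → i ≤ n →
        ((graphLaw k j n).map fun p => fun r : Fin (n - i + 1) =>
            k * deg (i + (r : ℕ)) (p (i - j + (r : ℕ))) i) =
          ((urnLaw (triangularMatrix k (2 * k)) (k ^ 2)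
              (j * (j - 1) + 2 * (i - j) * k - k ^ 2) (n - i)).map
            fun c => fun r : Fin (n - i + 1) => c (r : ℕ) 0) ∧
        ∀ x : ℕ,
          (degreeLaw k j n i (k + x)).toReal =
            ((x + k - 1).choose x : ℝ) *
              ∑ u ∈ Finset.range (x + 1), (-1 : ℝ) ^ u * (x.choose u : ℝ) *
                (fallingFactorial ((n : ℝ) - (j : ℝ) + (j : ℝ) * ((j : ℝ) - 1) / (2 * (k : ℝ)) -
                    ((u : ℝ) + (k : ℝ)) / 2 - 1) (n - i) /
                  fallingFactorial ((n : ℝ) - (j : ℝ) +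
                    (j : ℝ) * ((j : ℝ) - 1) / (2 * (k : ℝ)) - 1) (n - i))) := by
  refine ⟨fun α σ a₀ b₀ hα1 hα hs m x => urnLaw_white_apply hα1 hα hs m x,
    fun k j n i hk hkj hjn => ⟨fun hi hij => ?_, fun hji hin => ?_⟩⟩
  · obtain ⟨m, rfl⟩ := Nat.exists_eq_add_of_le hjn
    have hd : ∀ G, GraphInv k j (j + 0) G → deg (j + 0) G i = j - 1 := fun G hG =>
      hG.deg_seed rfl i (Finset.mem_Icc.2 ⟨hi, hij⟩)
    have hle : k * (j - 1) ≤ j * (j - 1) + 2 * k * 0 := by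
      simpa using Nat.mul_le_mul_right _ hkj
    constructor
    · have := graphLaw_map_deg hk hkj hi hij hd m
      simp only [Nat.zero_add, Nat.add_zero, Nat.mul_zero, ← Nat.sub_mul] at this
      rw [Nat.add_sub_cancel_left]
      exact this
    · intro x
      have := degreeLaw_apply hk hkj hi hij hd hle m x
      rw [choose_cast_shift x (j - 1) (by omega), show x + (j - 1) - 1 = x + j - 2 by omega,
        Nat.zero_add] at this
      rw [this, Nat.add_sub_cancel_left, Nat.cast_sub (by omega : 1 ≤ j)]
      congr 1
      refine Finset.sum_congr rfl fun u _ => ?_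
      congr 3 <;> · push_cast; ring
  · obtain ⟨r, rfl⟩ := Nat.exists_eq_add_of_le hji.le
    obtain ⟨m, rfl⟩ := Nat.exists_eq_add_of_le hin
    have hk0 : (k : ℝ) ≠ 0 := by
      have : 0 < k := by omega
      positivity
    have hd : ∀ G, GraphInv k j (j + r) G → deg (j + r) G (j + r) = k := fun G hG =>
      hG.deg_last hji
    -- Since `r ≥ 1` and `j ≥ k`, the right side is at least `k(k - 1) + 2k`.
    have hle : k * k ≤ j * (j - 1) + 2 * k * r := by
      obtain ⟨r, rfl⟩ : ∃ r', r = r' + 1 := ⟨r - 1, by omega⟩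
      obtain ⟨j, rfl⟩ : ∃ j', j = j' + 1 := ⟨j - 1, by omega⟩
      simp only [Nat.add_sub_cancel]
      nlinarith
    have h1 : j + r + m - (j + r) = m := by omega
    have h2 : j + r - j = r := by omega
    constructor
    · have := graphLaw_map_deg hk hkj (by omega : 1 ≤ j + r) le_rfl hd m
      rw [← add_assoc] at this
      rw [h1, h2, pow_two, mul_right_comm 2 r k]
      exact this
    · intro x
      have := degreeLaw_apply hk hkj (by omega : 1 ≤ j + r) le_rfl hd hle m x
      rw [choose_cast_shift x k (by omega), ← add_assoc] at this
      rw [this, h1]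
      congr 1
      refine Finset.sum_congr rfl fun u _ => ?_
      -- Here `n - j = r + m`; dividing by `2k` turns `2kr` into `r` and `k² + ku` into `(u + k)/2`.
      congr 3 <;> · push_cast; field_simp; ring
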